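/- For a finite digraph $G$ and $\alpha\in[0,1)$ let $A_\alpha(G)=\alpha D(G)+(1-\alpha)A(G)$, where $A(G)$ is the adjacency matrix and $D(G)$ the diagonal matrix of outdegrees, and let $\rho_\alpha(G)$ be the spectral radius of $A_\alpha(G)$. For integers $t\ge 1$ and $m\ge 2t-1$ let $\widetilde S^t_m$ be the set of integer vectors $(x_1,\dots,x_t)$ with $x_1\ge x_2\ge\dots\ge x_t\ge 1$, $\sum_i x_i=m$ and $x_{t-1}\ge 2$ (no condition on $x_{t-1}$ if $t=1$). For $\mathbf K_1=(k_1,\dots,k_s)\in\widetilde S^s_{m_1}$ and $\mathbf K_2=(l_1,\dots,l_t)\in\widetilde S^t_{m_2}$ with $s,t\ge 1$, let $\widetilde\Theta(\mathbf K_1,\mathbf K_2)$ be the simple digraph obtained from two vertices $u\ne v$ by adding internally disjoint directed paths, $s$ of them from $u$ to $v$ with lengths $k_1,\dots,k_s$ and $t$ of them from $v$ to $u$ with lengths $l_1,\dots,l_t$. Let $\widetilde{\boldsymbol\Theta}_k(m)$ be the class of all these digraphs (up to isomorphism) with $s+t=k$ and $m_1+m_2=m$, that is, the generalized theta digraphs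 of size $m$ with $k$ paths. Write $\zeta^m_t=(m-2t+3,2,\dots,2,1)$ with $t-2$ entries $2$ (for $t\ge 2$) and $\zeta_t=(2,\dots,2,1)$ with $t-1$ entries $2$ (so $\zeta_1=(1)$). **Theorem.** Let $k\ge 3$ and $m\ge 2k-2$ be integers, $s'=\lceil k/2\rceil$ and $t'=\lfloor k/2\rfloor$. Then there exists $\delta>0$ (which may depend on $k$ and $m$) such that: 1. for every $\alpha\in[0,\delta)$, $\widetilde\Theta(\zeta^{m-2t'+1}_{s'},\zeta_{t'})$ is, up to isomorphism, the unique digraph with the maximal $\rho_\alpha$ in $\widetilde{\boldsymbol\Theta}_k(m)$; 2. for every $\alpha\in(1-\delta,1)$, $\widetilde\Theta(\zeta^{m-1}_{k-1},\zeta_1)$ is, up to isomorphism, the unique digraph with the maximal $\rho_\alpha$ in $\widetilde{\boldsymbol\Theta}_k(m)$. -/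

import Mathlib

open scoped ENNReal

namespace ThetaDigraph

/-- The outdegree of a vertex. -/
noncomputable def outDegree {V : Type*} (G : Digraph V) (x : V) : ℕ :=
  Set.ncard {y : V | G.Adj x y}

open Classical in
/-- The adjacency matrix `A(G)`. -/
noncomputable def adjMatrix {V : Type*} (G : Digraph V) : Matrix V V ℝ :=
  Matrix.of fun x y => if G.Adj x y then 1 else 0

/-- The matrix `A_α(G) = α D(G) + (1 - α) A(G)`, where `D(G)` is the diagonal matrix of the
outdegrees. -/
noncomputable def alphaMatrix {V : Type*} [DecidableEq V] (α : ℝ) (G : Digraph V) :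
    Matrix V V ℝ :=
  α • Matrix.diagonal (fun x => (outDegree G x : ℝ)) + (1 - α) • adjMatrix G

/-- The `α`-spectral radius `ρ_α(G)`: the largest modulus of a complex eigenvalue of `A_α(G)`. -/
noncomputable def alphaSpectralRadius {V : Type*} [Fintype V] [DecidableEq V] (α : ℝ)
    (G : Digraph V) : ℝ≥0∞ :=
  spectralRadius ℂ ((alphaMatrix α G).map (fun r : ℝ => (r : ℂ)))

/-- Two digraphs are isomorphic. -/
def Isomorphic {V W : Type*} (G : Digraph V) (H : Digraph W) : Prop :=
  Nonempty (G.Adj ≃r H.Adj)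

/-- The admissible length vectors: nonincreasing vectors `x₁ ≥ ⋯ ≥ x_t ≥ 1` of integers with sum
`m` and `x_{t-1} ≥ 2` (no condition when `t = 1`). Indices start at `0` here. -/
def IsLengthVector (t m : ℕ) (x : Fin t → ℕ) : Prop :=
  Antitone x ∧ (∀ i, 1 ≤ x i) ∧ ∑ i, x i = m ∧ ∀ i : Fin t, (i : ℕ) + 2 = t → 2 ≤ x i

/-- The vertices of a generalized theta digraph: the two hubs `u = inl false`, `v = inl true`,
and, for each path of length `ℓ`, its `ℓ - 1` internal vertices. -/
abbrev Vertex {s t : ℕ} (K : Fin s → ℕ) (L : Fin t → ℕ) : Type :=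
  Bool ⊕ ((Σ i : Fin s, Fin (K i - 1)) ⊕ (Σ j : Fin t, Fin (L j - 1)))

/-- The vertex in position `p` (`0 ≤ p ≤ K i`) of the `i`-th path from `u` to `v`. -/
def forwardVertex {s t : ℕ} (K : Fin s → ℕ) (L : Fin t → ℕ) (i : Fin s) (p : ℕ) : Vertex K L :=
  if p = 0 then Sum.inl false
  else if h : p - 1 < K i - 1 then Sum.inr (Sum.inl ⟨i, ⟨p - 1, h⟩⟩)
  else Sum.inl true

/-- The vertex in position `p` (`0 ≤ p ≤ L j`) of the `j`-th path from `v` to `u`. -/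
def backwardVertex {s t : ℕ} (K : Fin s → ℕ) (L : Fin t → ℕ) (j : Fin t) (p : ℕ) : Vertex K L :=
  if p = 0 then Sum.inl true
  else if h : p - 1 < L j - 1 then Sum.inr (Sum.inr ⟨j, ⟨p - 1, h⟩⟩)
  else Sum.inl false

/-- The digraph `Θ̃(K, L)`: two vertices `u`, `v`, joined by internally disjoint directed paths of
lengths `K i` from `u` to `v` and of lengths `L j` from `v` to `u`. -/
def Theta {s t : ℕ} (K : Fin s → ℕ) (L : Fin t → ℕ) : Digraph (Vertex K L) where
  Adj x y :=
    (∃ (i : Fin s) (p : ℕ), p < K i ∧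
      x = forwardVertex K L i p ∧ y = forwardVertex K L i (p + 1)) ∨
    (∃ (j : Fin t) (p : ℕ), p < L j ∧
      x = backwardVertex K L j p ∧ y = backwardVertex K L j (p + 1))

/-- `G` is (isomorphic to) a generalized theta digraph of size `m` with `k` paths. -/
def IsGeneralizedTheta {V : Type*} (k m : ℕ) (G : Digraph V) : Prop :=
  ∃ (s t m₁ m₂ : ℕ) (K : Fin s → ℕ) (L : Fin t → ℕ),
    1 ≤ s ∧ 1 ≤ t ∧ s + t = k ∧ m₁ + m₂ = m ∧
    IsLengthVector s m₁ K ∧ IsLengthVector t m₂ L ∧ Isomorphic G (Theta K L)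

/-- `H` is, up to isomorphism, the unique digraph with the maximal `α`-spectral radius among the
generalized theta digraphs of size `m` with `k` paths. -/
def IsUniqueMaximizer {W : Type*} [Fintype W] [DecidableEq W] (α : ℝ) (k m : ℕ)
    (H : Digraph W) : Prop :=
  IsGeneralizedTheta k m H ∧
  ∀ (V : Type) [Fintype V] [DecidableEq V] (G : Digraph V), IsGeneralizedTheta k m G →
    alphaSpectralRadius α G ≤ alphaSpectralRadius α H ∧
    (alphaSpectralRadius α G = alphaSpectralRadius α H → Isomorphic G H)

/-- The vector `ζ^m_t = (m - 2t + 3, 2, …, 2, 1)` with `t - 2` entries `2`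
(and `ζ^m_1 = (m)`), used for `t ≥ 1` and `m ≥ 2t - 1`. -/
def zetaTop (t m : ℕ) : Fin t → ℕ := fun i =>
  if t = 1 then m
  else if (i : ℕ) + 1 = t then 1
  else if (i : ℕ) = 0 then m + 3 - 2 * t
  else 2

/-- The vector `ζ_t = (2, …, 2, 1)` with `t - 1` entries `2`. -/
def zeta (t : ℕ) : Fin t → ℕ := fun i => if (i : ℕ) + 1 = t then 1 else 2

end ThetaDigraph

namespace ThetaDigraph

/-- A nonnegative matrix with a positive eigenvector has the corresponding eigenvalue as its
spectral radius. -/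
theorem spectralRadius_eq_of_pos_eigenvector {V : Type*} [Fintype V] [DecidableEq V] [Nonempty V]
    (A : Matrix V V ℝ) (hA : ∀ i j, 0 ≤ A i j) (x : V → ℝ) (hx : ∀ i, 0 < x i) (lam : ℝ)
    (hlam : 0 ≤ lam) (h : ∀ i, ∑ j, A i j * x j = lam * x i) :
    spectralRadius ℂ (A.map (fun r : ℝ => (r : ℂ))) = ENNReal.ofReal lam := by
  have spec : ∀ μ : ℂ, μ ∈ spectrum ℂ (A.map (fun r : ℝ => (r : ℂ))) ↔
      ∃ v : V → ℂ, v ≠ 0 ∧ ∀ i, ∑ j, (A i j : ℂ) * v j = μ * v i := by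
    intro μ
    rw [← Matrix.spectrum_toLin', ← Module.End.hasEigenvalue_iff_mem_spectrum]
    constructor
    · intro hμ
      obtain ⟨v, hv⟩ := hμ.exists_hasEigenvector
      refine ⟨v, hv.2, fun i => ?_⟩
      have := congrFun hv.apply_eq_smul i
      simpa [Matrix.mulVec, dotProduct] using this
    · rintro ⟨v, hv, h⟩
      refine Module.End.hasEigenvalue_of_hasEigenvector (x := v) ⟨?_, hv⟩
      rw [Module.End.mem_eigenspace_iff]
      ext i
      simpa [Matrix.mulVec, dotProduct] using h i
  apply le_antisymm
  · refine iSup₂_le fun μ hμ => ?_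
    obtain ⟨v, hv, hv'⟩ := (spec μ).1 hμ
    obtain ⟨i, hi⟩ := Finite.exists_max (fun i => ‖v i‖ / x i)
    have hc : ∀ j, ‖v j‖ ≤ ‖v i‖ / x i * x j := fun j => by
      rw [← div_le_iff₀ (hx j)]; exact hi j
    have hvi : 0 < ‖v i‖ := by
      by_contra hneg
      have h0 : ‖v i‖ = 0 := le_antisymm (not_lt.1 hneg) (norm_nonneg _)
      apply hv
      ext j
      have := hc j
      rw [h0] at this
      simpa using this
    have key : ‖μ‖ * ‖v i‖ ≤ lam * ‖v i‖ := by
      calc ‖μ‖ * ‖v i‖ = ‖∑ j, (A i j : ℂ) * v j‖ := by rw [hv' i, norm_mul]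
        _ ≤ ∑ j, ‖(A i j : ℂ) * v j‖ := norm_sum_le _ _
        _ ≤ ∑ j, ‖v i‖ / x i * (A i j * x j) := by
            refine Finset.sum_le_sum fun j _ => ?_
            rw [norm_mul, Complex.norm_real, Real.norm_of_nonneg (hA i j)]
            calc A i j * ‖v j‖ ≤ A i j * (‖v i‖ / x i * x j) :=
                  mul_le_mul_of_nonneg_left (hc j) (hA i j)
              _ = _ := by ring
        _ = lam * ‖v i‖ := by
            rw [← Finset.mul_sum, h i]
            field_simp [(hx i).ne']
    have hle : ‖μ‖ ≤ lam := le_of_mul_le_mul_right key hvi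
    rw [← enorm_eq_nnnorm, ← ofReal_norm]
    exact ENNReal.ofReal_le_ofReal hle
  · have hmem : (lam : ℂ) ∈ spectrum ℂ (A.map (fun r : ℝ => (r : ℂ))) := by
      refine (spec _).2 ⟨fun i => (x i : ℂ), ?_, fun i => ?_⟩
      · intro h0
        obtain ⟨i⟩ := ‹Nonempty V›
        have := congrFun h0 i
        simp only [Pi.zero_apply, Complex.ofReal_eq_zero] at this
        exact (hx i).ne' this
      · simpa using congrArg Complex.ofReal (h i)
    refine le_trans ?_ (le_iSup₂ (f := fun k (_ : k ∈ spectrum ℂ _) => (‖k‖₊ : ℝ≥0∞)) _ hmem)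
    rw [← enorm_eq_nnnorm, ← ofReal_norm, Complex.norm_real, Real.norm_of_nonneg hlam]

theorem sum_adj_of_range {V : Type*} [Fintype V] (G : Digraph V) (w : V)
    {n : ℕ} (f : Fin n → V) (hf : Function.Injective f) (h : ∀ y, G.Adj w y ↔ ∃ i, f i = y)
    (x : V → ℝ) : outDegree G w = n ∧ ∑ y, adjMatrix G w y * x y = ∑ i, x (f i) := by
  classical
  constructor
  · have : {y | G.Adj w y} = Set.range f := by ext y; exact h y
    rw [outDegree, this, ← Set.image_univ, Set.ncard_image_of_injective _ hf]
    simp [Set.ncard_univ]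
  · have : ∀ y, adjMatrix G w y * x y = if y ∈ Finset.univ.image f then x y else 0 := by
      intro y
      simp [adjMatrix, h y]
    simp only [this]
    rw [← Finset.sum_filter, Finset.filter_mem_eq_inter, Finset.univ_inter,
      Finset.sum_image (fun a _ b _ hab => hf hab)]

theorem sum_alphaMatrix {V : Type*} [Fintype V] [DecidableEq V] (α : ℝ) (G : Digraph V) (w : V)
    {n : ℕ} (f : Fin n → V) (hf : Function.Injective f) (h : ∀ y, G.Adj w y ↔ ∃ i, f i = y)
    (x : V → ℝ) :
    ∑ y, alphaMatrix α G w y * x y = α * n * x w + (1 - α) * ∑ i, x (f i) := by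
  obtain ⟨h1, h2⟩ := sum_adj_of_range G w f hf h x
  rw [← h2, ← h1, Finset.mul_sum]
  simp [alphaMatrix, add_mul, Finset.sum_add_distrib, Matrix.diagonal_apply, mul_assoc]

theorem alphaMatrix_nonneg {V : Type*} [DecidableEq V] {α : ℝ} (h0 : 0 ≤ α) (h1 : α ≤ 1)
    (G : Digraph V) (i j : V) : 0 ≤ alphaMatrix α G i j := by
  have h1' : 0 ≤ 1 - α := by linarith
  have hd : (0 : ℝ) ≤ Matrix.diagonal (fun x => (outDegree G x : ℝ)) i j := by
    rw [Matrix.diagonal_apply]; split_ifs <;> positivity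
  have ha : 0 ≤ adjMatrix G i j := by
    simp only [adjMatrix, Matrix.of_apply]; split_ifs <;> norm_num
  simp only [alphaMatrix, Matrix.add_apply, Matrix.smul_apply, smul_eq_mul]
  positivity

theorem alphaSpectralRadius_congr {V W : Type*} [Fintype V] [DecidableEq V] [Fintype W]
    [DecidableEq W] {G : Digraph V} {H : Digraph W} (h : Isomorphic G H) (α : ℝ) :
    alphaSpectralRadius α G = alphaSpectralRadius α H := by
  obtain ⟨e⟩ := h
  have hdeg : ∀ x, outDegree G x = outDegree H (e x) := by
    intro x
    refine Set.ncard_congr (fun y _ => e y) (fun y hy => e.map_rel_iff.2 hy)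
      (fun a b _ _ hab => e.injective hab) (fun b hb => ⟨e.symm b, ?_, by simp⟩)
    have : H.Adj (e x) (e (e.symm b)) := by simpa using hb
    exact e.map_rel_iff.1 this
  have hmat : (alphaMatrix α H).map (fun r : ℝ => (r : ℂ)) =
      Matrix.reindexAlgEquiv ℂ ℂ e.toEquiv ((alphaMatrix α G).map (fun r : ℝ => (r : ℂ))) := by
    ext a b
    have hadj : G.Adj (e.symm a) (e.symm b) ↔ H.Adj a b := by
      rw [← e.map_rel_iff]; simp
    have hd : outDegree G (e.symm a) = outDegree H a := by rw [hdeg]; simp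
    have ha : adjMatrix G (e.symm a) (e.symm b) = adjMatrix H a b := by
      by_cases hb : H.Adj a b
      · simp [adjMatrix, hb, hadj.2 hb]
      · simp [adjMatrix, hb, mt hadj.1 hb]
    have hm : alphaMatrix α G (e.symm a) (e.symm b) = alphaMatrix α H a b := by
      simp [alphaMatrix, Matrix.diagonal_apply, ha, hd]
    exact congrArg Complex.ofReal hm.symm
  rw [alphaSpectralRadius, alphaSpectralRadius, hmat, spectralRadius, spectralRadius,
    AlgEquiv.spectrum_eq]

theorem Isomorphic.trans {U V W : Type*} {G : Digraph U} {H : Digraph V} {J : Digraph W}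
    (h : Isomorphic G H) (h' : Isomorphic H J) : Isomorphic G J :=
  ⟨h.some.trans h'.some⟩

/-- Exchanging the two hubs. -/
def swapEquiv {s t : ℕ} (K : Fin s → ℕ) (L : Fin t → ℕ) : Vertex K L ≃ Vertex L K :=
  Equiv.sumCongr Equiv.boolNot (Equiv.sumComm _ _)

theorem swapEquiv_forwardVertex {s t : ℕ} (K : Fin s → ℕ) (L : Fin t → ℕ) (i : Fin s) (p : ℕ) :
    swapEquiv K L (forwardVertex K L i p) = backwardVertex L K i p := by
  unfold forwardVertex backwardVertex swapEquiv
  split_ifs <;> rfl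

theorem swapEquiv_backwardVertex {s t : ℕ} (K : Fin s → ℕ) (L : Fin t → ℕ) (j : Fin t) (p : ℕ) :
    swapEquiv K L (backwardVertex K L j p) = forwardVertex L K j p := by
  unfold forwardVertex backwardVertex swapEquiv
  split_ifs <;> rfl

theorem adj_swap {s t : ℕ} (K : Fin s → ℕ) (L : Fin t → ℕ) (x y : Vertex K L) :
    (Theta L K).Adj (swapEquiv K L x) (swapEquiv K L y) ↔ (Theta K L).Adj x y := by
  simp only [Theta, ← swapEquiv_forwardVertex K L, ← swapEquiv_backwardVertex K L,
    EmbeddingLike.apply_eq_iff_eq]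
  exact or_comm

theorem isomorphic_swap {s t : ℕ} (K : Fin s → ℕ) (L : Fin t → ℕ) :
    Isomorphic (Theta K L) (Theta L K) :=
  ⟨⟨swapEquiv K L, adj_swap K L _ _⟩⟩

/-- The generating polynomial `∑ᵢ z ^ Kᵢ` of the path lengths. -/
noncomputable def pathSum {s : ℕ} (K : Fin s → ℕ) (z : ℝ) : ℝ := ∑ i, z ^ K i

/-- The function of `z` whose root in `(0, 1)` determines the spectral radius of `Θ̃(K, L)`. -/
noncomputable def charFun {s t : ℕ} (K : Fin s → ℕ) (L : Fin t → ℕ) (β z : ℝ) : ℝ :=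
  (1 - β * ((s : ℝ) - 1) * z) * (1 - β * ((t : ℝ) - 1) * z) - pathSum K z * pathSum L z

section Structure

variable {s t : ℕ} (K : Fin s → ℕ) (L : Fin t → ℕ)

theorem forwardVertex_succ {i : Fin s} {p : ℕ} (h : p < K i - 1) :
    forwardVertex K L i (p + 1) = Sum.inr (Sum.inl ⟨i, ⟨p, h⟩⟩) := by
  simp [forwardVertex, h]

theorem backwardVertex_succ {j : Fin t} {p : ℕ} (h : p < L j - 1) :
    backwardVertex K L j (p + 1) = Sum.inr (Sum.inr ⟨j, ⟨p, h⟩⟩) := by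
  simp [backwardVertex, h]

theorem forwardVertex_end {i : Fin s} {p : ℕ} (h : ¬ p < K i - 1) :
    forwardVertex K L i (p + 1) = Sum.inl true := by
  simp [forwardVertex, h]

theorem adj_left (hK : ∀ i, 1 ≤ K i) (y : Vertex K L) :
    (Theta K L).Adj (Sum.inl false) y ↔ ∃ i, forwardVertex K L i 1 = y := by
  constructor
  · rintro (⟨i, p, hp, hx, rfl⟩ | ⟨j, p, hp, hx, rfl⟩)
    · rcases p with _ | p
      · exact ⟨i, rfl⟩
      · rw [forwardVertex_succ K L (by omega)] at hx
        simp at hx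
    · rcases p with _ | p
      · simp [backwardVertex] at hx
      · rw [backwardVertex_succ K L (by omega)] at hx
        simp at hx
  · rintro ⟨i, rfl⟩
    exact Or.inl ⟨i, 0, hK i, rfl, rfl⟩

theorem adj_inner (i : Fin s) (p : Fin (K i - 1)) (y : Vertex K L) :
    (Theta K L).Adj (Sum.inr (Sum.inl ⟨i, p⟩)) y ↔
      ∃ _ : Fin 1, forwardVertex K L i (p + 1 + 1) = y := by
  constructor
  · rintro (⟨i', q, hq, hx, rfl⟩ | ⟨j, q, hq, hx, rfl⟩)
    · rcases q with _ | q
      · simp [forwardVertex] at hx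
      · rw [forwardVertex_succ K L (by omega)] at hx
        simp only [Sum.inr.injEq, Sum.inl.injEq, Sigma.mk.injEq] at hx
        obtain ⟨rfl, hx⟩ := hx
        rw [heq_eq_eq] at hx
        subst hx
        exact ⟨0, rfl⟩
    · rcases q with _ | q
      · simp [backwardVertex] at hx
      · rw [backwardVertex_succ K L (by omega)] at hx
        simp at hx
  · rintro ⟨_, rfl⟩
    have := p.2
    refine Or.inl ⟨i, p + 1, by omega, ?_, rfl⟩
    rw [forwardVertex_succ K L p.2]

theorem forwardVertex_one_injective
    (hK : ∀ i j, K i = 1 → K j = 1 → i = j) (h1 : ∀ i, 1 ≤ K i) :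
    Function.Injective fun i => forwardVertex K L i 1 := by
  intro i j hij
  by_cases hi : 0 < K i - 1 <;> by_cases hj : 0 < K j - 1
  · simp only [forwardVertex_succ K L (p := 0) hi, forwardVertex_succ K L (p := 0) hj] at hij
    simp only [Sum.inr.injEq, Sum.inl.injEq, Sigma.mk.injEq] at hij
    exact hij.1
  · simp only [forwardVertex_succ K L (p := 0) hi, forwardVertex_end K L (p := 0) hj] at hij
    simp at hij
  · simp only [forwardVertex_succ K L (p := 0) hj, forwardVertex_end K L (p := 0) hi] at hij
    simp at hij
  · have := h1 i
    have := h1 j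
    exact hK i j (by omega) (by omega)

/-- The candidate Perron vector of `Θ̃(K, L)`, with values `a` and `b` at the hubs. -/
noncomputable def hubVector (z a b : ℝ) : Vertex K L → ℝ
  | Sum.inl false => a
  | Sum.inl true => b
  | Sum.inr (Sum.inl ⟨i, p⟩) => z ^ (K i - (p + 1)) * b
  | Sum.inr (Sum.inr ⟨j, p⟩) => z ^ (L j - (p + 1)) * a

theorem hubVector_forwardVertex (z a b : ℝ) {i : Fin s} {p : ℕ} (hp : p < K i) :
    hubVector K L z a b (forwardVertex K L i (p + 1)) = z ^ (K i - (p + 1)) * b := by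
  by_cases h : p < K i - 1
  · rw [forwardVertex_succ K L h]; rfl
  · rw [forwardVertex_end K L h, show K i - (p + 1) = 0 by omega]
    simp [hubVector]

theorem hubVector_swap (z a b : ℝ) (w : Vertex K L) :
    hubVector L K z b a (swapEquiv K L w) = hubVector K L z a b w := by
  rcases w with (_ | _) | ⟨i, p⟩ | ⟨j, p⟩ <;> rfl

theorem hubVector_pos {z a b : ℝ} (hz : 0 < z) (ha : 0 < a) (hb : 0 < b) (w : Vertex K L) :
    0 < hubVector K L z a b w := by
  rcases w with (_ | _) | ⟨i, p⟩ | ⟨j, p⟩ <;> simp only [hubVector] <;> positivity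

/-- The eigenvalue equation at the first hub and on the paths leaving it. -/
theorem eigen_forward (hK : ∀ i j, K i = 1 → K j = 1 → i = j) (h1 : ∀ i, 1 ≤ K i)
    {β z a b : ℝ} (hβ : 0 ≤ β) (hz : 0 < z)
    (hab : (1 - β * ((s : ℝ) - 1) * z) * a = pathSum K z * b) :
    (∑ y, alphaMatrix (β / (1 + β)) (Theta K L) (Sum.inl false) y * hubVector K L z a b y =
      (β + 1 / z) / (1 + β) * a) ∧
    ∀ i (p : Fin (K i - 1)), ∑ y, alphaMatrix (β / (1 + β)) (Theta K L) (Sum.inr (Sum.inl ⟨i, p⟩)) y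
      * hubVector K L z a b y =
      (β + 1 / z) / (1 + β) * hubVector K L z a b (Sum.inr (Sum.inl ⟨i, p⟩)) := by
  have hβ' : 1 + β ≠ 0 := by positivity
  constructor
  · rw [sum_alphaMatrix _ _ _ _ (forwardVertex_one_injective K L hK h1) (adj_left K L h1)]
    have hsum : ∑ i, hubVector K L z a b (forwardVertex K L i 1) = pathSum K z * b / z := by
      rw [pathSum, Finset.sum_mul, Finset.sum_div]
      refine Finset.sum_congr rfl fun i _ => ?_
      rw [hubVector_forwardVertex K L z a b (p := 0) (h1 i)]
      obtain ⟨n, hn⟩ := Nat.exists_eq_add_of_le' (h1 i)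
      rw [hn, pow_succ]
      field_simp
      simp [mul_comm]
    rw [hsum, ← hab]
    simp only [hubVector]
    field_simp
    ring
  · intro i p
    rw [sum_alphaMatrix _ _ _ (fun _ : Fin 1 => forwardVertex K L i (p + 1 + 1))
      (Function.injective_of_subsingleton _) (adj_inner K L i p)]
    have hp := p.2
    have : hubVector K L z a b (forwardVertex K L i (p + 1 + 1)) = z ^ (K i - (p + 2)) * b :=
      hubVector_forwardVertex K L z a b (by omega)
    simp only [this, Finset.sum_const, Finset.card_univ, Fintype.card_fin, one_smul]
    simp only [hubVector]
    rw [show K i - (p + 1) = (K i - (p + 2)) + 1 by omega, pow_succ]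
    field_simp
    push_cast
    ring

theorem eigen_swap {c β z a b : ℝ} (w : Vertex K L)
    (h : ∑ y, alphaMatrix β (Theta L K) (swapEquiv K L w) y * hubVector L K z b a y =
      c * hubVector L K z b a (swapEquiv K L w)) :
    ∑ y, alphaMatrix β (Theta K L) w y * hubVector K L z a b y = c * hubVector K L z a b w := by
  have hdeg : outDegree (Theta L K) (swapEquiv K L w) = outDegree (Theta K L) w := by
    symm
    refine Set.ncard_congr (fun y _ => swapEquiv K L y) (fun y hy => (adj_swap K L w y).2 hy)
      (fun a b _ _ hab => (swapEquiv K L).injective hab)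
      (fun b hb => ⟨(swapEquiv K L).symm b, ?_, by simp⟩)
    rw [Set.mem_ofPred_eq, ← adj_swap]
    simpa using hb
  rw [hubVector_swap] at h
  rw [← h, ← (swapEquiv K L).sum_comp]
  refine Finset.sum_congr rfl fun y _ => ?_
  rw [hubVector_swap]
  have hadj : adjMatrix (Theta L K) (swapEquiv K L w) (swapEquiv K L y) =
      adjMatrix (Theta K L) w y := by
    by_cases hb : (Theta K L).Adj w y
    · simp [adjMatrix, hb, (adj_swap K L w y).2 hb]
    · simp [adjMatrix, hb, mt (adj_swap K L w y).1 hb]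
  simp [alphaMatrix, Matrix.diagonal_apply, hdeg, hadj]

end Structure

theorem pathSum_pos {s : ℕ} (hs : 1 ≤ s) (K : Fin s → ℕ) {z : ℝ} (h0 : 0 < z) :
    0 < pathSum K z := by
  have : Nonempty (Fin s) := ⟨⟨0, hs⟩⟩
  exact Finset.sum_pos (fun _ _ => by positivity) Finset.univ_nonempty

theorem alphaSpectralRadius_Theta {s t : ℕ} (K : Fin s → ℕ) (L : Fin t → ℕ) (hs : 1 ≤ s)
    (hK : ∀ i j, K i = 1 → K j = 1 → i = j) (hK1 : ∀ i, 1 ≤ K i)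
    (hL : ∀ i j, L i = 1 → L j = 1 → i = j) (hL1 : ∀ i, 1 ≤ L i)
    {β z : ℝ} (hβ : 0 ≤ β) (hz : 0 < z) (hsz : β * ((s : ℝ) - 1) * z < 1)
    (h0 : charFun K L β z = 0) :
    alphaSpectralRadius (β / (1 + β)) (Theta K L) = ENNReal.ofReal ((β + 1 / z) / (1 + β)) := by
  have hP := pathSum_pos hs K hz
  have hb : 0 < 1 - β * ((s : ℝ) - 1) * z := by linarith
  have hβ1 : β / (1 + β) ≤ 1 := by rw [div_le_one (by positivity)]; linarith
  refine spectralRadius_eq_of_pos_eigenvector _ (alphaMatrix_nonneg (by positivity) hβ1 _)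
    (hubVector K L z (pathSum K z) (1 - β * ((s : ℝ) - 1) * z)) (hubVector_pos K L hz hP hb) _
    (by positivity) ?_
  have hf := eigen_forward K L hK hK1 hβ hz (a := pathSum K z) (b := 1 - β * ((s : ℝ) - 1) * z)
    (by ring)
  have hg := eigen_forward L K hL hL1 hβ hz (b := pathSum K z) (a := 1 - β * ((s : ℝ) - 1) * z)
    (by unfold charFun at h0; linarith)
  rintro ((_ | _) | ⟨i, p⟩ | ⟨j, p⟩)
  · exact hf.1
  · exact eigen_swap K L _ hg.1
  · exact hf.2 i p
  · exact eigen_swap K L _ (hg.2 j p)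

theorem IsLengthVector.eq_of_eq_one {s m : ℕ} {K : Fin s → ℕ} (h : IsLengthVector s m K)
    (i j : Fin s) (hi : K i = 1) (hj : K j = 1) : i = j := by
  obtain ⟨ha, -, -, h2⟩ := h
  have key : ∀ i : Fin s, K i = 1 → (i : ℕ) + 1 = s := by
    intro i hi
    by_contra hne
    have hlt := i.2
    have h3 := h2 ⟨s - 2, by omega⟩ (by simp only; omega)
    have h4 := ha (show i ≤ ⟨s - 2, by omega⟩ from Fin.le_def.2 (by simp only; omega))
    omega
  have := key i hi
  have := key j hj
  ext
  omega

theorem continuous_charFun {s t : ℕ} (K : Fin s → ℕ) (L : Fin t → ℕ) (β : ℝ) :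
    Continuous (charFun K L β) := by
  unfold charFun pathSum
  fun_prop

theorem pathSum_le {s : ℕ} {K : Fin s → ℕ} (hK : ∀ i, 1 ≤ K i) {z : ℝ} (h0 : 0 ≤ z)
    (h1 : z ≤ 1) : pathSum K z ≤ s * z := by
  calc pathSum K z ≤ ∑ _i : Fin s, z :=
        Finset.sum_le_sum fun i _ => pow_le_of_le_one h0 h1 (by have := hK i; omega)
    _ = s * z := by simp

theorem pathSum_mono {s : ℕ} (K : Fin s → ℕ) {y z : ℝ} (h0 : 0 ≤ y) (h : y ≤ z) :
    pathSum K y ≤ pathSum K z :=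
  Finset.sum_le_sum fun _ _ => pow_le_pow_left₀ h0 h _

theorem pathSum_strictMono {s : ℕ} (hs : 1 ≤ s) {K : Fin s → ℕ} (hK : ∀ i, 1 ≤ K i) {y z : ℝ}
    (h0 : 0 ≤ y) (h : y < z) : pathSum K y < pathSum K z := by
  have : Nonempty (Fin s) := ⟨⟨0, hs⟩⟩
  refine Finset.sum_lt_sum_of_nonempty Finset.univ_nonempty fun i _ =>
    pow_lt_pow_left₀ h h0 (by have := hK i; omega)

theorem exists_root {s t : ℕ} (K : Fin s → ℕ) (L : Fin t → ℕ) (hs : 1 ≤ s) (ht : 1 ≤ t)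
    (hst : 3 ≤ s + t) (hK : ∀ i, 1 ≤ K i) {β : ℝ} (hβ : 0 ≤ β) :
    ∃ z, 0 < z ∧ z < 1 ∧ β * ((s : ℝ) - 1) * z < 1 ∧ β * ((t : ℝ) - 1) * z < 1 ∧
      charFun K L β z = 0 := by
  have hs' : (1 : ℝ) ≤ s := by exact_mod_cast hs
  have ht' : (1 : ℝ) ≤ t := by exact_mod_cast ht
  have hst' : (3 : ℝ) ≤ s + t := by exact_mod_cast hst
  set c : ℝ := max 1 (max (β * ((s : ℝ) - 1)) (β * ((t : ℝ) - 1))) with hc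
  have hc1 : 1 ≤ c := le_max_left _ _
  have hcs : β * ((s : ℝ) - 1) ≤ c := (le_max_left _ _).trans (le_max_right _ _)
  have hct : β * ((t : ℝ) - 1) ≤ c := (le_max_right _ _).trans (le_max_right _ _)
  have hc0 : 0 < c := by linarith
  have hu : 0 ≤ β * ((s : ℝ) - 1) := mul_nonneg hβ (by linarith)
  have hv : 0 ≤ β * ((t : ℝ) - 1) := mul_nonneg hβ (by linarith)
  have hend : charFun K L β (1 / c) < 0 := by
    have hPK := pathSum_pos hs K (z := 1 / c) (by positivity)
    have hPL := pathSum_pos ht L (z := 1 / c) (by positivity)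
    rcases max_choice 1 (max (β * ((s : ℝ) - 1)) (β * ((t : ℝ) - 1))) with h | h
    · rw [← hc] at h
      rw [h] at hcs hct ⊢
      simp only [charFun, pathSum, one_div, inv_one, one_pow, mul_one, Finset.sum_const,
        Finset.card_univ, Fintype.card_fin, nsmul_eq_mul]
      have h2 : (1 - β * ((s : ℝ) - 1)) * (1 - β * ((t : ℝ) - 1)) ≤ 1 * 1 :=
        mul_le_mul (by linarith) (by linarith) (by linarith) zero_le_one
      have h3 : 2 ≤ (s : ℝ) * t := by nlinarith [mul_nonneg (sub_nonneg.2 hs') (sub_nonneg.2 ht')]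
      linarith
    · rw [← hc] at h
      have : (1 - β * ((s : ℝ) - 1) * (1 / c)) * (1 - β * ((t : ℝ) - 1) * (1 / c)) = 0 := by
        rcases max_choice (β * ((s : ℝ) - 1)) (β * ((t : ℝ) - 1)) with h' | h'
        · rw [← h.trans h', mul_one_div_cancel hc0.ne']; ring
        · rw [← h.trans h', mul_one_div_cancel hc0.ne']; ring
      unfold charFun
      rw [this]
      nlinarith
  have hstart : 0 < charFun K L β 0 := by
    have hz : ∀ {n : ℕ} (M : Fin n → ℕ), (∀ i, 1 ≤ M i) → pathSum M 0 = 0 := by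
      intro n M hM
      exact Finset.sum_eq_zero fun i _ => zero_pow (by have := hM i; omega)
    simp [charFun, hz K hK]
  obtain ⟨z, hz, hz0⟩ := intermediate_value_Ioo' (a := (0 : ℝ)) (b := 1 / c) (by positivity)
    (continuous_charFun K L β).continuousOn ⟨hend, hstart⟩
  have hzc : c * z < 1 := by
    have := hz.2
    rwa [lt_div_iff₀ hc0, mul_comm] at this
  refine ⟨z, hz.1, ?_, ?_, ?_, hz0⟩
  · nlinarith [hz.1]
  · nlinarith [hz.1]
  · nlinarith [hz.1]

/-- Where the linear factors are nonnegative, a nonnegative value of `charFun` forces the root to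
lie further right. -/
theorem le_root {s t : ℕ} (K : Fin s → ℕ) (L : Fin t → ℕ) (hs : 1 ≤ s) (ht : 1 ≤ t)
    (hK : ∀ i, 1 ≤ K i) {β y z : ℝ} (hβ : 0 ≤ β) (hy : 0 < y)
    (hsz : β * ((s : ℝ) - 1) * z ≤ 1) (htz : β * ((t : ℝ) - 1) * z ≤ 1)
    (hy0 : charFun K L β y = 0) (hz0 : 0 ≤ charFun K L β z) : z ≤ y := by
  by_contra! hlt
  have hs' : (0 : ℝ) ≤ (s : ℝ) - 1 := by rw [sub_nonneg]; exact_mod_cast hs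
  have ht' : (0 : ℝ) ≤ (t : ℝ) - 1 := by rw [sub_nonneg]; exact_mod_cast ht
  have h1 : β * ((s : ℝ) - 1) * y ≤ β * ((s : ℝ) - 1) * z := by gcongr
  have h2 : β * ((t : ℝ) - 1) * y ≤ β * ((t : ℝ) - 1) * z := by gcongr
  have h3 : (1 - β * ((s : ℝ) - 1) * z) * (1 - β * ((t : ℝ) - 1) * z) ≤
      (1 - β * ((s : ℝ) - 1) * y) * (1 - β * ((t : ℝ) - 1) * y) :=
    mul_le_mul (by linarith) (by linarith) (by linarith) (by linarith)
  have h4 : pathSum K y * pathSum L y < pathSum K z * pathSum L z :=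
    mul_lt_mul (pathSum_strictMono hs hK hy.le hlt) (pathSum_mono L hy.le hlt.le)
      (pathSum_pos ht L hy) (pathSum_pos hs K (hy.trans hlt)).le
  unfold charFun at hy0 hz0
  linarith

/-- The value of `pathSum` at a vector of `s - 1` entries `2` and one entry `1`. -/
def shortSum (s z : ℝ) : ℝ := z + (s - 1) * z ^ 2

theorem one_sub_pow_sum_le {ι : Type*} [DecidableEq ι] (S : Finset ι) (b : ι → ℕ) {z : ℝ}
    (h0 : 0 < z) (h1 : z < 1) :
    1 - z ^ (∑ i ∈ S, b i) ≤ ∑ i ∈ S, (1 - z ^ b i) ∧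
    (∑ i ∈ S, (1 - z ^ b i) = 1 - z ^ (∑ i ∈ S, b i) →
      ∀ i ∈ S, ∀ j ∈ S, i ≠ j → b i = 0 ∨ b j = 0) := by
  have hp : ∀ n : ℕ, z ^ n ≤ 1 := fun n => pow_le_one₀ h0.le h1.le
  have hp0 : ∀ n : ℕ, 1 - z ^ n = 0 → n = 0 := fun n hn => by
    by_contra h
    have := pow_lt_one₀ h0.le h1 h
    linarith
  induction S using Finset.induction_on with
  | empty => simp
  | insert a S ha ih =>
    obtain ⟨ih1, ih2⟩ := ih
    rw [Finset.sum_insert ha, Finset.sum_insert ha, pow_add]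
    have hprod : 0 ≤ (1 - z ^ b a) * (1 - z ^ (∑ i ∈ S, b i)) :=
      mul_nonneg (sub_nonneg.2 (hp _)) (sub_nonneg.2 (hp _))
    refine ⟨by linarith, fun heq => ?_⟩
    have h2 : (1 - z ^ b a) * (1 - z ^ (∑ i ∈ S, b i)) = 0 := by linarith
    have hS := ih2 (by linarith)
    have haS : ∀ j ∈ S, b a = 0 ∨ b j = 0 := by
      intro j hj
      rcases mul_eq_zero.1 h2 with h | h
      · exact Or.inl (hp0 _ h)
      · exact Or.inr (Finset.sum_eq_zero_iff.1 (hp0 _ h) j hj)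
    intro i hi j hj hij
    rw [Finset.mem_insert] at hi hj
    rcases hi with rfl | hi <;> rcases hj with rfl | hj
    · exact absurd rfl hij
    · exact haS j hj
    · exact (haS i hi).symm
    · exact hS i hi j hj hij

theorem IsLengthVector.two_mul_le {s m : ℕ} {K : Fin s → ℕ} (h : IsLengthVector s m K)
    (hs : 1 ≤ s) : 2 * s ≤ m + 1 := by
  obtain ⟨n, rfl⟩ := Nat.exists_eq_add_of_le' hs
  obtain ⟨hanti, hpos, hsum, h2⟩ := h
  have hK : ∀ i : Fin n, 2 ≤ K i.castSucc := by
    intro i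
    have hi := i.2
    have h3 := h2 ⟨n - 1, by omega⟩ (by simp only; omega)
    have h4 := hanti (show i.castSucc ≤ ⟨n - 1, by omega⟩ from Fin.le_def.2 (by simp; omega))
    omega
  have h5 : ∑ _i : Fin n, 2 ≤ ∑ i : Fin n, K i.castSucc := Finset.sum_le_sum fun i _ => hK i
  have h6 := hpos (Fin.last n)
  rw [Fin.sum_univ_castSucc] at hsum
  simp only [Finset.sum_const, Finset.card_univ, Fintype.card_fin, smul_eq_mul] at h5
  omega

/-- Among length vectors, the path sum is largest when all the excess length is on one path. -/
theorem IsLengthVector.pathSum_le_shortSum {s m a : ℕ} {K : Fin s → ℕ} (h : IsLengthVector s m K)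
    (hs : 1 ≤ s) (hm : m + 1 = 2 * s + a) {z : ℝ} (h0 : 0 < z) (h1 : z < 1) :
    pathSum K z ≤ shortSum s z - z ^ 2 * (1 - z ^ a) ∧
    (pathSum K z = shortSum s z - z ^ 2 * (1 - z ^ a) → K = zetaTop s m) := by
  obtain ⟨n, rfl⟩ := Nat.exists_eq_add_of_le' hs
  obtain ⟨hanti, hpos, hsum, h2⟩ := h
  set b : Fin n → ℕ := fun i => K i.castSucc - 2 with hb
  set c : ℕ := K (Fin.last n) - 1 with hc
  have hKb : ∀ i : Fin n, K i.castSucc = b i + 2 := by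
    intro i
    have hi := i.2
    have h3 := h2 ⟨n - 1, by omega⟩ (by simp only; omega)
    have h4 := hanti (show i.castSucc ≤ ⟨n - 1, by omega⟩ from Fin.le_def.2 (by simp; omega))
    simp only [hb]
    omega
  have hKc : K (Fin.last n) = c + 1 := by have := hpos (Fin.last n); omega
  have hac : ∑ i, b i + c = a := by
    rw [Fin.sum_univ_castSucc] at hsum
    simp only [hKb, hKc, Finset.sum_add_distrib, Finset.sum_const, Finset.card_univ,
      Fintype.card_fin, smul_eq_mul] at hsum
    omega
  have hP : pathSum K z = shortSum ((n + 1 : ℕ) : ℝ) z - z ^ 2 * ∑ i, (1 - z ^ b i) -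
      z * (1 - z ^ c) := by
    rw [pathSum, Fin.sum_univ_castSucc, shortSum]
    simp only [hKb, hKc, Finset.sum_sub_distrib, Finset.sum_const, Finset.card_univ,
      Fintype.card_fin, nsmul_eq_mul, pow_add, ← Finset.sum_mul]
    push_cast
    ring
  obtain ⟨hle, heq⟩ := one_sub_pow_sum_le Finset.univ b h0 h1
  have hzc : z ^ c ≤ 1 := pow_le_one₀ h0.le h1.le
  have hzb : z ^ (∑ i, b i) ≤ 1 := pow_le_one₀ h0.le h1.le
  have ha : z ^ a = z ^ (∑ i, b i) * z ^ c := by rw [← hac, pow_add]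
  have hz2 : 0 < z ^ 2 := by positivity
  have g1 : 0 ≤ z * (1 - z) * (1 - z ^ c) :=
    mul_nonneg (mul_nonneg h0.le (by linarith)) (by linarith)
  have g2 : 0 ≤ z ^ 2 * (∑ i, (1 - z ^ b i) - (1 - z ^ (∑ i, b i))) :=
    mul_nonneg hz2.le (by linarith)
  have g3 : 0 ≤ z ^ 2 * ((1 - z ^ (∑ i, b i)) * (1 - z ^ c)) :=
    mul_nonneg hz2.le (mul_nonneg (by linarith) (by linarith))
  have hid : shortSum ((n + 1 : ℕ) : ℝ) z - z ^ 2 * (1 - z ^ a) - pathSum K z =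
      z * (1 - z) * (1 - z ^ c) + z ^ 2 * (∑ i, (1 - z ^ b i) - (1 - z ^ (∑ i, b i))) +
      z ^ 2 * ((1 - z ^ (∑ i, b i)) * (1 - z ^ c)) := by
    rw [hP, ha]; ring
  refine ⟨by linarith, fun he => ?_⟩
  have e1 : z * (1 - z) * (1 - z ^ c) = 0 := by linarith
  have e2 : z ^ 2 * (∑ i, (1 - z ^ b i) - (1 - z ^ (∑ i, b i))) = 0 := by linarith
  have hc0 : c = 0 := by
    by_contra hne
    have := pow_lt_one₀ h0.le h1 hne
    have : 0 < z * (1 - z) * (1 - z ^ c) :=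
      mul_pos (mul_pos h0 (by linarith)) (by linarith)
    linarith
  have hone := heq (sub_eq_zero.1 ((mul_eq_zero.1 e2).resolve_left hz2.ne'))
  have hb0 : ∀ i : Fin n, (i : ℕ) ≠ 0 → b i = 0 := by
    intro i hi
    have hin := i.2
    rcases hone ⟨0, by omega⟩ (Finset.mem_univ _) i (Finset.mem_univ _)
      (fun h => hi (by rw [← h])) with h | h
    · have h5 := hanti (show (⟨0, by omega⟩ : Fin n).castSucc ≤ i.castSucc from
        Fin.le_def.2 (by simp))
      rw [hKb, hKb] at h5
      omega
    · exact h
  ext i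
  refine Fin.lastCases ?_ (fun i => ?_) i
  · rw [hKc, hc0]
    rcases n with _ | n
    · simp at hac
      simp [zetaTop]; omega
    · simp [zetaTop]
  · have hin := i.2
    rw [hKb]
    by_cases hi : (i : ℕ) = 0
    · have hsb : ∑ j, b j = b i := Finset.sum_eq_single_of_mem i (Finset.mem_univ _)
        (fun j _ hj => hb0 j fun h => hj (Fin.ext (h.trans hi.symm)))
      simp [zetaTop, hi]
      rw [if_neg (by omega), if_neg (by omega)]
      omega
    · rw [hb0 i hi]
      simp [zetaTop, hi]
      rw [if_neg (by omega), if_neg (by omega)]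

theorem isLengthVector_zetaTop {s m : ℕ} (hs : 1 ≤ s) (hm : 2 * s ≤ m + 1) :
    IsLengthVector s m (zetaTop s m) := by
  refine ⟨?_, ?_, ?_, ?_⟩
  · intro i j hij
    have := j.2
    rw [Fin.le_def] at hij
    simp only [zetaTop]
    split_ifs <;> omega
  · intro i
    simp only [zetaTop]
    split_ifs <;> omega
  · obtain ⟨n, rfl⟩ := Nat.exists_eq_add_of_le' hs
    rcases n with _ | n
    · simp [zetaTop]
    · rw [Fin.sum_univ_castSucc, Fin.sum_univ_succ]
      have : ∀ i : Fin n, (i : ℕ) ≠ n := fun i => i.2.ne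
      simp [zetaTop, this]
      omega
  · intro i hi
    simp only [zetaTop]
    split_ifs <;> omega

theorem pathSum_zetaTop {s m a : ℕ} (hs : 1 ≤ s) (hm : m + 1 = 2 * s + a) (ha : s = 1 → a = 0)
    (z : ℝ) : pathSum (zetaTop s m) z = shortSum s z - z ^ 2 * (1 - z ^ a) := by
  obtain ⟨n, rfl⟩ := Nat.exists_eq_add_of_le' hs
  rcases n with _ | n
  · have := ha rfl
    subst this
    simp only [show m = 1 by omega]
    simp [pathSum, zetaTop, shortSum]
  · rw [pathSum, Fin.sum_univ_castSucc, Fin.sum_univ_succ, shortSum]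
    have : ∀ i : Fin n, (i : ℕ) ≠ n := fun i => i.2.ne
    simp [zetaTop, this]
    rw [show m + 3 - 2 * (n + 1 + 1) = a + 2 by omega]
    ring

theorem zeta_eq_zetaTop {t : ℕ} (ht : 1 ≤ t) : zeta t = zetaTop t (2 * t - 1) := by
  ext i
  have := i.2
  simp only [zeta, zetaTop]
  split_ifs <;> omega

/-- The criterion used to identify the maximizer: `charFun` of every competitor is nonnegative at
the root belonging to the candidate, and vanishes only for isomorphic digraphs. -/
theorem isUniqueMaximizer_of_charFun {k m s₀ t₀ m₁ m₂ : ℕ} (hk : 3 ≤ k) {K₀ : Fin s₀ → ℕ}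
    {L₀ : Fin t₀ → ℕ} (hs₀ : 1 ≤ s₀) (ht₀ : 1 ≤ t₀) (hst₀ : s₀ + t₀ = k) (hm₀ : m₁ + m₂ = m)
    (hK₀ : IsLengthVector s₀ m₁ K₀) (hL₀ : IsLengthVector t₀ m₂ L₀) {α : ℝ} (h0 : 0 ≤ α)
    (h1 : α < 1)
    (H : ∀ z : ℝ, 0 < z → z < 1 → α / (1 - α) * ((s₀ : ℝ) - 1) * z < 1 →
      α / (1 - α) * ((t₀ : ℝ) - 1) * z < 1 →
      charFun K₀ L₀ (α / (1 - α)) z = 0 → ∀ (s t m₁ m₂ : ℕ) (K : Fin s → ℕ) (L : Fin t → ℕ),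
      1 ≤ s → 1 ≤ t → t ≤ s → s + t = k → m₁ + m₂ = m → IsLengthVector s m₁ K →
      IsLengthVector t m₂ L →
      α / (1 - α) * ((s : ℝ) - 1) * z ≤ 1 ∧ α / (1 - α) * ((t : ℝ) - 1) * z ≤ 1 ∧
      0 ≤ charFun K L (α / (1 - α)) z ∧
      (charFun K L (α / (1 - α)) z = 0 → Isomorphic (Theta K L) (Theta K₀ L₀))) :
    IsUniqueMaximizer α k m (Theta K₀ L₀) := by
  have hα : 0 < 1 - α := by linarith
  set β := α / (1 - α) with hβd
  have hβ : 0 ≤ β := by positivity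
  have hαβ : α = β / (1 + β) := by rw [hβd]; field_simp; ring
  have radius : ∀ {s t m₁ m₂ : ℕ} (K : Fin s → ℕ) (L : Fin t → ℕ), 1 ≤ s →
      IsLengthVector s m₁ K → IsLengthVector t m₂ L → ∀ z, 0 < z → β * ((s : ℝ) - 1) * z < 1 →
      charFun K L β z = 0 →
      alphaSpectralRadius α (Theta K L) = ENNReal.ofReal ((β + 1 / z) / (1 + β)) := by
    intro s t m₁ m₂ K L hs hK hL z hz hsz hz0
    rw [hαβ]
    exact alphaSpectralRadius_Theta K L hs hK.eq_of_eq_one hK.2.1 hL.eq_of_eq_one hL.2.1 hβ hz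
      hsz hz0
  obtain ⟨z, hz, hz1, hsz, htz, hz0⟩ := exists_root K₀ L₀ hs₀ ht₀ (by omega) hK₀.2.1 hβ
  refine ⟨⟨s₀, t₀, m₁, m₂, K₀, L₀, hs₀, ht₀, hst₀, hm₀, hK₀, hL₀, ⟨RelIso.refl _⟩⟩, ?_⟩
  intro V _ _ G hG
  have hG' : ∃ (s t m₁ m₂ : ℕ) (K : Fin s → ℕ) (L : Fin t → ℕ),
      1 ≤ s ∧ 1 ≤ t ∧ t ≤ s ∧ s + t = k ∧ m₁ + m₂ = m ∧
      IsLengthVector s m₁ K ∧ IsLengthVector t m₂ L ∧ Isomorphic G (Theta K L) := by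
    obtain ⟨s, t, m₁, m₂, K, L, hs, ht, hst, hm, hK, hL, hiso⟩ := hG
    rcases le_total t s with h | h
    · exact ⟨s, t, m₁, m₂, K, L, hs, ht, h, hst, hm, hK, hL, hiso⟩
    · exact ⟨t, s, m₂, m₁, L, K, ht, hs, h, by omega, by omega, hL, hK,
        hiso.trans (isomorphic_swap K L)⟩
  obtain ⟨s, t, n₁, n₂, K, L, hs, ht, hts, hst, hm, hK, hL, hiso⟩ := hG'
  obtain ⟨y, hy, -, hsy, -, hy0⟩ := exists_root K L hs ht (by omega) hK.2.1 hβ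
  obtain ⟨c1, c2, c3, c4⟩ := H z hz hz1 hsz htz hz0 s t n₁ n₂ K L hs ht hts hst hm hK hL
  have hzy := le_root K L hs ht hK.2.1 hβ hy c1 c2 hy0 c3
  rw [alphaSpectralRadius_congr hiso, radius K L hs hK hL y hy hsy hy0,
    radius K₀ L₀ hs₀ hK₀ hL₀ z hz hsz hz0]
  refine ⟨ENNReal.ofReal_le_ofReal (by gcongr), fun heq => ?_⟩
  rw [ENNReal.ofReal_eq_ofReal_iff (by positivity) (by positivity),
    div_left_inj' (by positivity)] at heq
  have hyz : y = z := by
    have : 1 / y = 1 / z := by linarith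
    simpa using this
  exact hiso.trans (c4 (hyz ▸ hy0))

/-- The difference of `charFun` between bounds for a digraph with hub outdegrees `T + d + e` and
`T - e` and excess lengths `a`, `b`, and the candidate with hub outdegrees `T + d` and `T`. -/
theorem charFun_bound_sub (β z T d e : ℝ) (a b : ℕ) :
    ((1 - β * (T + d + e - 1) * z) * (1 - β * (T - e - 1) * z) -
      (shortSum (T + d + e) z - z ^ 2 * (1 - z ^ a)) * (shortSum (T - e) z - z ^ 2 * (1 - z ^ b))) -
    ((1 - β * (T + d - 1) * z) * (1 - β * (T - 1) * z) -
      (shortSum (T + d) z - z ^ 2 * (1 - z ^ (a + b))) * shortSum T z) =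
    (e ^ 2 + e * d) * (z ^ 4 - β ^ 2 * z ^ 2) +
      z ^ 2 * ((1 - z ^ a) * (1 - z ^ b)) * (shortSum T z - z ^ 2) +
      z ^ 4 * ((1 - z ^ b) * d + e * ((1 - z ^ b) - (1 - z ^ a))) := by
  unfold shortSum
  rw [pow_add]
  ring

theorem eq_of_mul_eq_of_le {x y u v : ℝ} (hx : 0 < x) (hy : 0 < y) (hxu : x ≤ u) (hyv : y ≤ v)
    (h : x * y = u * v) : x = u ∧ y = v := by
  constructor
  · nlinarith [mul_nonneg (sub_nonneg.2 hxu) hy.le, mul_nonneg (hx.le.trans hxu) (sub_nonneg.2 hyv)]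
  · nlinarith [mul_nonneg (sub_nonneg.2 hyv) hx.le, mul_nonneg (hy.le.trans hyv) (sub_nonneg.2 hxu)]

theorem one_sub_pow_nonneg {z : ℝ} (h0 : 0 < z) (h1 : z < 1) (n : ℕ) : 0 ≤ 1 - z ^ n :=
  sub_nonneg.2 (pow_le_one₀ h0.le h1.le)

theorem eq_zero_of_one_sub_pow {z : ℝ} (h0 : 0 < z) (h1 : z < 1) {n : ℕ} (h : 1 - z ^ n = 0) :
    n = 0 := by
  by_contra hn
  have := pow_lt_one₀ h0.le h1 hn
  linarith

theorem shortSum_sub_pos {z : ℝ} (h0 : 0 < z) (h1 : z < 1) {n : ℕ} (hn : 1 ≤ n) :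
    0 < shortSum n z - z ^ 2 := by
  have h2 : (0 : ℝ) ≤ (n : ℝ) - 1 := by rw [sub_nonneg]; exact_mod_cast hn
  have h3 : 0 ≤ ((n : ℝ) - 1) * z ^ 2 := by positivity
  have h4 : z ^ 2 < z := by nlinarith
  unfold shortSum
  linarith

theorem unbalanced_gap_pos {z β d e : ℝ} (h0 : 0 < z) (h1 : z < 1) (a b : ℕ)
    (hβ : β ^ 2 < z ^ (a + b + 2)) (he : 1 ≤ e) (hd : 0 ≤ d) :
    0 < (e ^ 2 + e * d) * (z ^ 4 - β ^ 2 * z ^ 2) +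
      z ^ 4 * ((1 - z ^ b) * d + e * ((1 - z ^ b) - (1 - z ^ a))) := by
  have he0 : 0 < e := by linarith
  have hq := one_sub_pow_nonneg h0 h1 b
  have hp : z ^ (a + b) ≤ z ^ a := pow_le_pow_of_le_one h0.le h1.le (by omega)
  have hw := one_sub_pow_nonneg h0 h1 (a + b)
  have g1 : 0 < (e ^ 2 + e * d) * (z ^ 2 * (z ^ (a + b + 2) - β ^ 2)) :=
    mul_pos (by positivity) (mul_pos (by positivity) (by linarith))
  have g2 : 0 ≤ z ^ 4 * (e * (e + d - 1) * (1 - z ^ (a + b))) :=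
    mul_nonneg (by positivity) (mul_nonneg (mul_nonneg he0.le (by linarith)) hw)
  have g3 : 0 ≤ z ^ 4 * ((1 - z ^ b) * (d + e) + e * (z ^ a - z ^ (a + b))) :=
    mul_nonneg (by positivity) (add_nonneg (mul_nonneg hq (by linarith))
      (mul_nonneg he0.le (by linarith)))
  have g4 : (e ^ 2 + e * d) * (z ^ 4 - β ^ 2 * z ^ 2) +
      z ^ 4 * ((1 - z ^ b) * d + e * ((1 - z ^ b) - (1 - z ^ a))) =
      (e ^ 2 + e * d) * (z ^ 2 * (z ^ (a + b + 2) - β ^ 2)) +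
      z ^ 4 * (e * (e + d - 1) * (1 - z ^ (a + b))) +
      z ^ 4 * ((1 - z ^ b) * (d + e) + e * (z ^ a - z ^ (a + b))) := by
    rw [pow_add z (a + b) 2]
    ring
  linarith

theorem root_ge {s t k : ℕ} (K : Fin s → ℕ) (L : Fin t → ℕ) (hk : 0 < k) (hs : 1 ≤ s)
    (ht : 1 ≤ t) (hsk : s ≤ k) (htk : t ≤ k) (hK : ∀ i, 1 ≤ K i) (hL : ∀ i, 1 ≤ L i)
    {β z : ℝ} (hβ1 : β ≤ 1) (hz : 0 < z) (hz1 : z < 1)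
    (h0 : charFun K L β z = 0) : 1 / (2 * (k : ℝ)) ≤ z := by
  by_contra! hlt
  have hk' : (0 : ℝ) < k := by exact_mod_cast hk
  have hkz : k * z < 1 / 2 := by
    rw [lt_div_iff₀ (by positivity)] at hlt
    linarith
  have side : ∀ {n : ℕ} (M : Fin n → ℕ), 1 ≤ n → n ≤ k → (∀ i, 1 ≤ M i) →
      pathSum M z < 1 / 2 ∧ 1 / 2 < 1 - β * ((n : ℝ) - 1) * z := by
    intro n M hn hnk hM
    have hn' : (1 : ℝ) ≤ n := by exact_mod_cast hn
    have hnk' : (n : ℝ) ≤ k := by exact_mod_cast hnk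
    have h1 : (n : ℝ) * z ≤ k * z := by gcongr
    have h2 : β * (((n : ℝ) - 1) * z) ≤ 1 * (((n : ℝ) - 1) * z) :=
      mul_le_mul_of_nonneg_right hβ1 (mul_nonneg (by linarith) hz.le)
    exact ⟨(pathSum_le hM hz.le hz1.le).trans_lt (by linarith), by linarith⟩
  obtain ⟨a1, a2⟩ := side K hs hsk hK
  obtain ⟨b1, b2⟩ := side L ht htk hL
  have h1 := mul_lt_mul'' a1 b1 (pathSum_pos hs K hz).le (pathSum_pos ht L hz).le
  have h2 := mul_lt_mul'' a2 b2 (by norm_num) (by norm_num)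
  unfold charFun at h0
  linarith

set_option maxHeartbeats 1000000 in
theorem isUniqueMaximizer_balanced {k m s₀ t₀ : ℕ} (hk : 3 ≤ k) (hm : 2 * k - 2 ≤ m)
    (hst₀ : s₀ + t₀ = k) (hd : s₀ = t₀ ∨ s₀ = t₀ + 1) {α : ℝ} (h0 : 0 ≤ α)
    (h1 : α < (1 / (2 * (k : ℝ))) ^ (m + 4 - 2 * k) / 2) :
    IsUniqueMaximizer α k m (Theta (zetaTop s₀ (m + 1 - 2 * t₀)) (zeta t₀)) := by
  have ht₀ : 1 ≤ t₀ := by omega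
  have hs₀ : 2 ≤ s₀ := by omega
  obtain ⟨N, rfl⟩ : ∃ N, m = N + (2 * k - 2) := ⟨m - (2 * k - 2), by omega⟩
  rw [show N + (2 * k - 2) + 4 - 2 * k = N + 2 by omega] at h1
  have hk' : (3 : ℝ) ≤ k := by exact_mod_cast hk
  set r : ℝ := 1 / (2 * (k : ℝ)) with hr
  have hr0 : 0 < r := by positivity
  have hrk : r * k = 1 / 2 := by rw [hr]; field_simp
  have hr1 : r ≤ 1 / 6 := by nlinarith
  have hc : r ^ (N + 2) ≤ r := pow_le_of_le_one hr0.le (by linarith) (by omega)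
  have hα1 : 0 < 1 - α := by linarith
  have hβ0 : 0 ≤ α / (1 - α) := by positivity
  have hβc : α / (1 - α) < r ^ (N + 2) := by
    rw [div_lt_iff₀ hα1]
    nlinarith
  rw [zeta_eq_zetaTop ht₀]
  refine isUniqueMaximizer_of_charFun hk (by omega) ht₀ hst₀
    (m₁ := N + (2 * k - 2) + 1 - 2 * t₀) (m₂ := 2 * t₀ - 1) (by omega)
    (isLengthVector_zetaTop (by omega) (by omega)) (isLengthVector_zetaTop ht₀ (by omega)) h0
    (by linarith) ?_
  generalize α / (1 - α) = β at *
  intro z hz hz1 _ _ hz0 s t m₁ m₂ K L hs ht hts hst hm₁₂ hK hL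
  have hrz : r ≤ z := root_ge _ _ (by omega) (by omega) ht₀ (by omega) (by omega)
    (isLengthVector_zetaTop (by omega) (by omega)).2.1
    (isLengthVector_zetaTop ht₀ (by omega)).2.1 (by linarith) hz hz1 hz0
  have hβz : β ^ 2 < z ^ (N + 2) := by
    have : r ^ (N + 2) ≤ z ^ (N + 2) := by gcongr
    nlinarith
  have hβk : β * k ≤ 1 := by nlinarith
  have hlin : ∀ n : ℕ, n ≤ k → β * ((n : ℝ) - 1) * z ≤ 1 := by
    intro n hn
    have hn' : (n : ℝ) ≤ k := by exact_mod_cast hn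
    have h3 : β * ((n : ℝ) - 1) ≤ 1 := by nlinarith
    nlinarith
  refine ⟨hlin s (by omega), hlin t (by omega), ?_⟩
  obtain ⟨e, rfl⟩ : ∃ e, s = s₀ + e := ⟨s - s₀, by omega⟩
  obtain ⟨d, rfl⟩ : ∃ d, s₀ = t₀ + d := ⟨s₀ - t₀, by omega⟩
  obtain rfl : t₀ = t + e := by omega
  have hlenK := hK.two_mul_le hs
  have hlenL := hL.two_mul_le ht
  obtain ⟨a, ha⟩ : ∃ a, m₁ + 1 = 2 * (t + e + d + e) + a := ⟨_, (Nat.add_sub_cancel' hlenK).symm⟩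
  obtain ⟨b, hb⟩ : ∃ b, m₂ + 1 = 2 * t + b := ⟨_, (Nat.add_sub_cancel' hlenL).symm⟩
  obtain rfl : N = a + b := by omega
  obtain ⟨hX, hXe⟩ := hK.pathSum_le_shortSum hs ha hz hz1
  obtain ⟨hY, hYe⟩ := hL.pathSum_le_shortSum ht hb hz hz1
  have hX0 := pathSum_pos hs K hz
  have hY0 := pathSum_pos ht L hz
  have hXY := mul_le_mul hX hY hY0.le (hX0.le.trans hX)
  have hid := charFun_bound_sub β z ((t + e : ℕ) : ℝ) d e a b
  have hz0' := hz0
  rw [charFun, pathSum_zetaTop (a := a + b) (by omega) (by omega) (by omega),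
    pathSum_zetaTop (a := 0) (by omega) (by omega) (by omega)] at hz0'
  have hp := one_sub_pow_nonneg hz hz1 a
  have hq := one_sub_pow_nonneg hz hz1 b
  have hT := shortSum_sub_pos hz hz1 (show 1 ≤ t + e by omega)
  have hpq : 0 ≤ z ^ 2 * ((1 - z ^ a) * (1 - z ^ b)) * (shortSum ((t + e : ℕ) : ℝ) z - z ^ 2) := by
    positivity
  push_cast at hid hz0' hXY hX hY hpq hT hXe hYe
  simp only [pow_zero, sub_self, mul_zero, sub_zero] at hz0'
  rw [show (t : ℝ) + e - e = t by ring, hz0', sub_zero] at hid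
  have hG : charFun K L β z = (1 - β * ((t : ℝ) + e + d + e - 1) * z) * (1 - β * (t - 1) * z) -
      pathSum K z * pathSum L z := by
    unfold charFun; push_cast; ring
  rcases Nat.eq_zero_or_pos e with rfl | he
  · simp only [Nat.cast_zero, zero_mul, add_zero, zero_add, ne_eq, OfNat.ofNat_ne_zero,
      not_false_eq_true, zero_pow] at *
    have hqd : 0 ≤ z ^ 4 * ((1 - z ^ b) * (d : ℝ)) := by positivity
    refine ⟨by linarith, fun hGz => ?_⟩
    have e1 : z ^ 2 * ((1 - z ^ a) * (1 - z ^ b)) * (shortSum (t : ℝ) z - z ^ 2) = 0 := by linarith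
    have e2 : z ^ 4 * ((1 - z ^ b) * (d : ℝ)) = 0 := by linarith
    obtain ⟨e3, e4⟩ := eq_of_mul_eq_of_le hX0 hY0 hX hY (by linarith)
    have hKe := hXe e3
    have hLe := hYe e4
    have hab : a = 0 ∨ b = 0 := by
      have := (mul_eq_zero.1 ((mul_eq_zero.1 e1).resolve_right hT.ne')).resolve_left (by positivity)
      rcases mul_eq_zero.1 this with h | h
      · exact Or.inl (eq_zero_of_one_sub_pow hz hz1 h)
      · exact Or.inr (eq_zero_of_one_sub_pow hz hz1 h)
    have hdb : d = 0 ∨ b = 0 := by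
      rcases mul_eq_zero.1 ((mul_eq_zero.1 e2).resolve_left (by positivity)) with h | h
      · exact Or.inr (eq_zero_of_one_sub_pow hz hz1 h)
      · exact Or.inl (by exact_mod_cast h)
    rw [hKe, hLe]
    by_cases hb0 : b = 0
    · obtain rfl : m₁ = a + b + (2 * k - 2) + 1 - 2 * t := by omega
      obtain rfl : m₂ = 2 * t - 1 := by omega
      exact ⟨RelIso.refl _⟩
    · obtain rfl := hab.resolve_right hb0
      obtain rfl := hdb.resolve_right hb0
      obtain rfl : m₂ = 0 + b + (2 * k - 2) + 1 - 2 * t := by omega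
      obtain rfl : m₁ = 2 * t - 1 := by omega
      exact isomorphic_swap _ _
  · have he' : (1 : ℝ) ≤ e := by exact_mod_cast he
    have hgap := unbalanced_gap_pos hz hz1 a b hβz he' (Nat.cast_nonneg (α := ℝ) d)
    have hpos : 0 < charFun K L β z := by
      rw [hG]
      clear hz0 hz0' hG hX hY hXe hYe
      linarith only [hXY, hid, hpq, hgap]
    exact ⟨hpos.le, fun h => absurd h hpos.ne'⟩

theorem isUniqueMaximizer_unbalanced {k m : ℕ} (hk : 3 ≤ k) (hm : 2 * k - 2 ≤ m) {α : ℝ}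
    (h0 : 1 - 1 / ((k : ℝ) + 1) < α) (h1 : α < 1) :
    IsUniqueMaximizer α k m (Theta (zetaTop (k - 1) (m - 1)) (zeta 1)) := by
  have hk' : (3 : ℝ) ≤ k := by exact_mod_cast hk
  have hα1 : 0 < 1 - α := by linarith
  have hα0 : 0 ≤ α := by
    have : 1 / ((k : ℝ) + 1) ≤ 1 := by rw [div_le_one (by positivity)]; linarith
    linarith
  have hβ : (k : ℝ) < α / (1 - α) := by
    have : (1 - α) * (k + 1) < 1 := by
      rw [← lt_div_iff₀ (by positivity)]
      linarith
    rw [lt_div_iff₀ hα1]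
    linarith
  rw [zeta_eq_zetaTop le_rfl]
  refine isUniqueMaximizer_of_charFun hk (by omega) le_rfl (by omega) (m₁ := m - 1)
    (m₂ := 2 * 1 - 1) (by omega) (isLengthVector_zetaTop (by omega) (by omega))
    (isLengthVector_zetaTop le_rfl (by omega)) hα0 h1 ?_
  generalize α / (1 - α) = β at *
  intro z hz hz1 hsz _ hz0 s t m₁ m₂ K L hs ht hts hst hm₁₂ hK hL
  have hk1 : ((k - 1 : ℕ) : ℝ) = k - 1 := by rw [Nat.cast_sub (by omega), Nat.cast_one]
  have hβz : 0 < β * z := mul_pos (by linarith) hz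
  have hlin : ∀ n : ℕ, n ≤ k - 1 → β * ((n : ℝ) - 1) * z ≤ 1 := by
    intro n hn
    have hn' : (n : ℝ) ≤ (k - 1 : ℕ) := by exact_mod_cast hn
    have h3 : β * z * (n : ℝ) ≤ β * z * (k - 1 : ℕ) := mul_le_mul_of_nonneg_left hn' hβz.le
    linarith
  refine ⟨hlin s (by omega), hlin t (by omega), ?_⟩
  obtain ht1 | ht2 : t = 1 ∨ 2 ≤ t := by omega
  · subst ht1
    obtain rfl : s = k - 1 := by omega
    have hlenK := hK.two_mul_le hs
    have hm₂ : L 0 = m₂ := by simpa using hL.2.2.1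
    have hlenL : 1 ≤ m₂ := hm₂ ▸ hL.2.1 0
    obtain ⟨a, ha⟩ : ∃ a, m₁ + 1 = 2 * (k - 1) + a := ⟨_, (Nat.add_sub_cancel' hlenK).symm⟩
    obtain ⟨b, rfl⟩ : ∃ b, m₂ = b + 1 := Nat.exists_eq_add_of_le' hlenL
    obtain ⟨hX, hXe⟩ := hK.pathSum_le_shortSum hs ha hz hz1
    have hY : pathSum L z = z ^ b * z := by simp [pathSum, hm₂, pow_succ]
    have hq := one_sub_pow_nonneg hz hz1 b
    have hS := shortSum_sub_pos hz hz1 hs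
    unfold charFun at hz0 ⊢
    rw [pathSum_zetaTop (a := a + b) (by omega) (by omega) (by omega),
      pathSum_zetaTop (a := 0) (by omega) (by omega) (by omega)] at hz0
    have g1 : 0 ≤ z ^ b * z * (shortSum ((k - 1 : ℕ) : ℝ) z - z ^ 2 * (1 - z ^ a) - pathSum K z) :=
      mul_nonneg (by positivity) (by linarith)
    have g2 : 0 ≤ z * (1 - z ^ b) * (shortSum ((k - 1 : ℕ) : ℝ) z - z ^ 2) :=
      mul_nonneg (mul_nonneg hz.le hq) hS.le
    have hone : shortSum ((1 : ℕ) : ℝ) z - z ^ 2 * (1 - z ^ 0) = z := by simp [shortSum]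
    rw [hone] at hz0
    rw [hY]
    have hid : (1 - β * (((k - 1 : ℕ) : ℝ) - 1) * z) * (1 - β * (((1 : ℕ) : ℝ) - 1) * z) -
        pathSum K z * (z ^ b * z) =
        z ^ b * z * (shortSum ((k - 1 : ℕ) : ℝ) z - z ^ 2 * (1 - z ^ a) - pathSum K z) +
        z * (1 - z ^ b) * (shortSum ((k - 1 : ℕ) : ℝ) z - z ^ 2) := by
      rw [pow_add] at hz0
      linear_combination hz0
    rw [hid]
    refine ⟨by linarith, fun hsum => ?_⟩
    have e1 : z ^ b * z * (shortSum ((k - 1 : ℕ) : ℝ) z - z ^ 2 * (1 - z ^ a) - pathSum K z) = 0 := by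
      linarith
    have e2 : z * (1 - z ^ b) * (shortSum ((k - 1 : ℕ) : ℝ) z - z ^ 2) = 0 := by linarith
    have hKe := hXe (sub_eq_zero.1 ((mul_eq_zero.1 e1).resolve_left (by positivity))).symm
    obtain rfl : b = 0 := eq_zero_of_one_sub_pow hz hz1
      ((mul_eq_zero.1 ((mul_eq_zero.1 e2).resolve_right hS.ne')).resolve_left hz.ne')
    have hLe : L = zetaTop 1 (2 * 1 - 1) := by
      ext i
      rw [Subsingleton.elim i 0, hm₂]
      rfl
    obtain rfl : m₁ = m - 1 := by omega
    rw [hKe, hLe]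
    exact ⟨RelIso.refl _⟩
  · have hfac : ∀ n : ℕ, n ≤ k - 2 → β * z < 1 - β * ((n : ℝ) - 1) * z := by
      intro n hn
      have hn' : ((n + 1 : ℕ) : ℝ) ≤ (k - 1 : ℕ) := by exact_mod_cast (by omega)
      have h3 : β * z * ((n + 1 : ℕ) : ℝ) ≤ β * z * (k - 1 : ℕ) :=
        mul_le_mul_of_nonneg_left hn' hβz.le
      push_cast at h3
      linarith
    have hsum : ∀ {n : ℕ} (M : Fin n → ℕ), n ≤ k → (∀ i, 1 ≤ M i) → pathSum M z ≤ β * z := by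
      intro n M hn hM
      have hn' : (n : ℝ) ≤ k := by exact_mod_cast hn
      exact (pathSum_le hM hz.le hz1.le).trans (by gcongr; linarith)
    have h2 := mul_lt_mul'' (hfac s (by omega)) (hfac t (by omega)) hβz.le hβz.le
    have h3 := mul_le_mul (hsum K (by omega) hK.2.1) (hsum L (by omega) hL.2.1)
      (pathSum_pos ht L hz).le hβz.le
    have hpos : 0 < charFun K L β z := by unfold charFun; linarith
    exact ⟨hpos.le, fun h => absurd h hpos.ne'⟩

end ThetaDigraph

theorem mainTheorem8 (k m : ℕ) (hk : 3 ≤ k) (hm : 2 * k - 2 ≤ m) :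
    ∃ δ : ℝ, 0 < δ ∧
      (∀ α : ℝ, α ∈ Set.Ico 0 δ →
        ThetaDigraph.IsUniqueMaximizer α k m
          (ThetaDigraph.Theta
            (ThetaDigraph.zetaTop ((k + 1) / 2) (m + 1 - 2 * (k / 2)))
            (ThetaDigraph.zeta (k / 2)))) ∧
      (∀ α : ℝ, α ∈ Set.Ioo (1 - δ) 1 →
        ThetaDigraph.IsUniqueMaximizer α k m
          (ThetaDigraph.Theta
            (ThetaDigraph.zetaTop (k - 1) (m - 1))
            (ThetaDigraph.zeta 1))) := by
  refine ⟨min ((1 / (2 * (k : ℝ))) ^ (m + 4 - 2 * k) / 2) (1 / ((k : ℝ) + 1)), ?_, ?_, ?_⟩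
  · have : (0 : ℝ) < k := by exact_mod_cast (by omega : 0 < k)
    positivity
  · rintro α ⟨h0, h1⟩
    exact ThetaDigraph.isUniqueMaximizer_balanced hk hm (by omega) (by omega) h0
      (h1.trans_le (min_le_left _ _))
  · rintro α ⟨h0, h1⟩
    refine ThetaDigraph.isUniqueMaximizer_unbalanced hk hm (lt_of_le_of_lt ?_ h0) h1
    have := min_le_right ((1 / (2 * (k : ℝ))) ^ (m + 4 - 2 * k) / 2) (1 / ((k : ℝ) + 1))
    linarith
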